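/- Let $d\ge 1$, let $\Delta\ge 3$ be an integer with $\Delta\ge 2d$ (so that every vertex of $\mathbb{Z}^d$ has at most $\Delta$ neighbours; for $d\ge 2$ one takes $\Delta=2d$), and let $$0<\lambda<\frac{(\Delta-1)^{\Delta-1}}{(\Delta-2)^{\Delta}} .$$ Consider $\mathbb{Z}^d$ as a graph in which $u,v$ are adjacent iff $\sum_j|u_j-v_j|=1$. For a finite $A\subset\mathbb{Z}^d$ let $Z_A=\sum_I\lambda^{|I|}$, the sum being over all independent sets $I\subseteq A$, and let $\partial A$ be the set of points of $A$ that have a neighbour outside $A$. Let $B_n=\{v:\sum_j|v_j|\le n\}$, and let $\mathbb{Z}^d_{\prec 0}$ consist of the origin and of all $v\in\mathbb{Z}^d$ whose last non-zero coordinate is negative. Recursion. For every finite $A\subset\mathbb{Z}^d$ and $v\in A$ fix an arbitrary enumeration $v_1,\dots,v_k$ of the neighbours of $v$ in $A$. Put $\Phi_A(v,0)=1$, $\Psi_A(v,0)=0$, and for $t\ge 1$ $$\Phi_A(v,t)=\Bigl(1+\lambda\prod_{i=1}^k\Phi_{A\setminus\{v,v_1,\dots,v_{i-1}\}}(v_i,t-1)\Bigr)^{-1},$$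 and likewise for $\Psi$ (an empty product is $1$). Let $\Phi(t)$ and $\Psi(t)$ be the values of $\Phi_A(0,t)$ and $\Psi_A(0,t)$ for $A=\mathbb{Z}^d_{\prec 0}\cap B_n$, where $n\ge t+1$ is arbitrary. Then the free energy $$\mathcal{P}(d,\lambda)=\lim_{n\to\infty}\frac{\log Z_{\Lambda_n}}{|\Lambda_n|}$$ exists and is the same for all increasing sequences $\Lambda_1\subset\Lambda_2\subset\cdots$ of finite subsets of $\mathbb{Z}^d$ with $0\in\Lambda_1$, $\max\{r:B_r\subset\Lambda_n\}\to\infty$ and $|\partial\Lambda_n|/|\Lambda_n|\to 0$. Moreover, for every choice of the enumerations, every integer $t\ge 0$, and every admissible $n$ in the definition of $\Phi(\cdot)$ and $\Psi(\cdot)$, $$-\log\Phi(2t)\le\mathcal{P}(d,\lambda)\le-\log\Psi(2t),$$ $$-\log\Psi(2t+1)\le\mathcal{P}(d,\lambda)\le-\log\Phi(2t+1),$$ where $-\log 0=+\infty$ (this occurs only for $\Psi(0)=0$). -/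

import Mathlib

/-- The lattice graph on `ℤ^d`: two points are adjacent iff their `ℓ¹` distance is `1`. -/
def latticeGraph (d : ℕ) : SimpleGraph (Fin d → ℤ) where
  Adj v u := ∑ j, |v j - u j| = 1
  symm := ⟨fun v u h => by simpa only [abs_sub_comm] using h⟩
  loopless := ⟨fun v h => by simp at h⟩

/-- The ball `B_r` around the origin of `ℤ^d` (graph distance in `ℤ^d` is the `ℓ¹` distance). -/
noncomputable def latticeBall (d r : ℕ) : Finset (Fin d → ℤ) :=
  (Fintype.piFinset fun _ => Finset.Icc (-(r : ℤ)) (r : ℤ)).filter fun v => ∑ j, |v j| ≤ (r : ℤ)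

/-- The lexicographic order `v ≺ u` on `ℤ^d`; the last coordinate is the most significant one. -/
def LexPrec {d : ℕ} (v u : Fin d → ℤ) : Prop :=
  ∃ k, v k < u k ∧ ∀ j, k < j → v j = u j

open Classical in
/-- The vertex set of `ℤ^d_{≺0} ∩ B_n`, where `ℤ^d_{≺0} = {u : u ≺ 0} ∪ {0}`. -/
noncomputable def halfBall (d n : ℕ) : Finset (Fin d → ℤ) :=
  (latticeBall d n).filter fun v => LexPrec v 0 ∨ v = 0

open Classical in
/-- The hard-core partition function `∑ lam ^ |I|` of the subgraph of `Γ` induced by the finite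
set `A`; the sum is over all independent sets `I ⊆ A`. -/
noncomputable def hardCoreZ {V : Type*} (Γ : SimpleGraph V) (lam : ℝ) (A : Finset V) : ℝ :=
  ∑ I ∈ A.powerset.filter (fun I : Finset V => Γ.IsIndepSet (I : Set V)), lam ^ I.card

open Classical in
/-- The inner boundary `∂A`: the points of `A` that have a neighbour outside `A`. -/
noncomputable def innerBoundary {V : Type*} (Γ : SimpleGraph V) (A : Finset V) : Finset V :=
  A.filter fun v => ∃ u, Γ.Adj v u ∧ u ∉ A

/-- An increasing sequence of finite subsets of `ℤ^d` containing the origin and eventually every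
ball, whose boundary is asymptotically negligible. -/
structure IsExhaustion (d : ℕ) (Λ : ℕ → Finset (Fin d → ℤ)) : Prop where
  zero_mem : 0 ∈ Λ 0
  mono : Monotone Λ
  ball_subset : ∀ r : ℕ, ∀ᶠ n in Filter.atTop, latticeBall d r ⊆ Λ n
  boundary : Filter.Tendsto
    (fun n => ((innerBoundary (latticeGraph d) (Λ n)).card : ℝ) / ((Λ n).card : ℝ))
    Filter.atTop (nhds 0)

/-- `p` is the free energy (pressure) of the hard-core model on `ℤ^d` with activity `lam`:
`log Z_{Λ_n} / |Λ_n| → p` along every exhaustion. -/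
def IsFreeEnergy (d : ℕ) (lam p : ℝ) : Prop :=
  ∀ Λ : ℕ → Finset (Fin d → ℤ), IsExhaustion d Λ →
    Filter.Tendsto
      (fun n => Real.log (hardCoreZ (latticeGraph d) lam (Λ n)) / ((Λ n).card : ℝ))
      Filter.atTop (nhds p)

/-- `e` enumerates neighbourhoods: for every finite set `A` and every `v ∈ A`, the list `e A v`
lists, without repetition, the neighbours of `v` in the subgraph of `Γ` induced by `A`. -/
def IsNbrEnum {V : Type*} (Γ : SimpleGraph V) (e : Finset V → V → List V) : Prop :=
  ∀ A : Finset V, ∀ v ∈ A, (e A v).Nodup ∧ ∀ u, u ∈ e A v ↔ u ∈ A ∧ Γ.Adj v u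

/-- The truncated cavity recursion on the subgraph induced by `A`, with initial value `x₀` at
depth `0`. If `e A v = [v₁, …, v_k]`, the value at `v` and depth `t + 1` is
`1 / (1 + lam * ∏ i, value at v_i and depth t in A \ {v, v₁, …, v_{i-1}})`.
For `k = 0` the product is `1` and the value is `1 / (1 + lam)`. -/
noncomputable def cavityRec {V : Type*} [DecidableEq V] (lam x₀ : ℝ)
    (e : Finset V → V → List V) : ℕ → Finset V → V → ℝ
  | 0, _, _ => x₀
  | t + 1, A, v =>
      (1 + lam * ∏ i : Fin (e A v).length,
        cavityRec lam x₀ e t ((A.erase v) \ ((e A v).take (i : ℕ)).toFinset)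
          ((e A v).get i))⁻¹

/-- `Φ(t)`, computed at the origin of `ℤ^d_{≺0} ∩ B_n`: the recursion started from `1`. -/
noncomputable def latticePhi (d : ℕ) (lam : ℝ)
    (e : Finset (Fin d → ℤ) → (Fin d → ℤ) → List (Fin d → ℤ)) (n t : ℕ) : ℝ :=
  cavityRec lam 1 e t (halfBall d n) 0

/-- `Ψ(t)`, computed at the origin of `ℤ^d_{≺0} ∩ B_n`: the recursion started from `0`. -/
noncomputable def latticePsi (d : ℕ) (lam : ℝ)
    (e : Finset (Fin d → ℤ) → (Fin d → ℤ) → List (Fin d → ℤ)) (n t : ℕ) : ℝ :=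
  cavityRec lam 0 e t (halfBall d n) 0

/-- `-log x` for `x ≥ 0`, as an extended real number; `-log 0 = +∞`. -/
noncomputable def negLog (x : ℝ) : EReal := -ENNReal.log (ENNReal.ofReal x)

/-!
By the chain rule for the lexicographic order, `log Z_Λ` is the sum over `v ∈ Λ` of `-log` of the
probability that `v` is vacant in the hard-core model on the vertices of `Λ` that weakly precede
`v`. Vacancy probabilities satisfy the cavity recursion exactly, and each step of the recursion is
antitone, so the recursion truncated at depth `t` with the trivial initial bounds `0` and `1` gives
alternating lower and upper bounds that only see the ball of radius `t`. If that ball lies inside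
`Λ`, translating `v` to the origin turns these bounds into the values on the half ball, and the
remaining vertices form a collar of negligible size. The limit itself exists by tiling: `log Z` is
subadditive over disjoint cubes, and additive up to deleting the inner boundary of each cube.
-/

section PartitionFunction

variable {V W : Type*} (Γ : SimpleGraph V) {lam : ℝ}

@[simp] lemma hardCoreZ_empty : hardCoreZ Γ lam ∅ = 1 := by
  classical
  simp [hardCoreZ, Finset.filter_singleton, SimpleGraph.IsIndepSet]

lemma hardCoreZ_map {Γ' : SimpleGraph W} (f : Γ ↪g Γ') (A : Finset V) :
    hardCoreZ Γ' lam (A.map f.toEmbedding) = hardCoreZ Γ lam A := by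
  classical
  have hpowerset : (A.map f.toEmbedding).powerset =
      A.powerset.map (Finset.mapEmbedding f.toEmbedding).toEmbedding := by
    ext I
    simp [Finset.subset_map_iff, eq_comm]
  have hindep (I : Finset V) :
      Γ'.IsIndepSet (I.map f.toEmbedding : Set W) ↔ Γ.IsIndepSet (I : Set V) := by
    simp [SimpleGraph.IsIndepSet, Set.Pairwise]
  simp only [hardCoreZ, hpowerset, Finset.filter_map, Finset.sum_map, Function.comp_def,
    RelEmbedding.coe_toEmbedding, Finset.mapEmbedding_apply, hindep, Finset.card_map]

open Classical in
lemma subset_and_isIndepSet_insert_iff {A I : Finset V} {v : V} (hv : v ∉ A) :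
    I ⊆ A ∧ Γ.IsIndepSet (insert v (I : Set V)) ↔
      I ⊆ A.filter (fun u => ¬ Γ.Adj v u) ∧ Γ.IsIndepSet (I : Set V) := by
  have : Std.Symm fun a b => ¬ Γ.Adj a b := ⟨fun a b h h' => h h'.symm⟩
  simp only [Finset.subset_iff, Finset.mem_filter, SimpleGraph.IsIndepSet,
    Set.pairwise_insert_of_symm, Finset.mem_coe]
  grind

open Classical in
lemma hardCoreZ_eq_erase_add_mul [DecidableEq V] {A : Finset V} {v : V} (hv : v ∈ A) :
    hardCoreZ Γ lam A = hardCoreZ Γ lam (A.erase v) +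
      lam * hardCoreZ Γ lam ((A.erase v).filter fun u => ¬ Γ.Adj v u) := by
  have hvA := Finset.notMem_erase v A
  have hfilter : hardCoreZ Γ lam ((A.erase v).filter fun u => ¬ Γ.Adj v u) =
      ∑ I ∈ (A.erase v).powerset,
        if Γ.IsIndepSet (insert v (I : Set V)) then lam ^ I.card else 0 := by
    rw [hardCoreZ, ← Finset.sum_filter]
    refine Finset.sum_congr (Finset.ext fun I => ?_) fun _ _ => rfl
    simp only [Finset.mem_filter, Finset.mem_powerset,
      subset_and_isIndepSet_insert_iff Γ hvA]
  have hweight : ∀ I ∈ (A.erase v).powerset,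
      lam ^ (insert v I).card = lam * lam ^ I.card := fun I hI => by
    rw [Finset.card_insert_of_notMem fun h => hvA (Finset.mem_powerset.1 hI h), pow_succ']
  conv_lhs => rw [← Finset.insert_erase hv]
  rw [hfilter, hardCoreZ, hardCoreZ, Finset.sum_filter, Finset.sum_filter,
    Finset.sum_powerset_insert hvA, Finset.mul_sum]
  simp only [mul_ite, mul_zero, Finset.coe_insert]
  exact congrArg _ (Finset.sum_congr rfl fun I hI => by rw [hweight I hI])

variable {Γ}

lemma hardCoreZ_mono (hlam : 0 ≤ lam) {A B : Finset V} (h : A ⊆ B) :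
    hardCoreZ Γ lam A ≤ hardCoreZ Γ lam B := by
  classical
  exact Finset.sum_le_sum_of_subset_of_nonneg
    (Finset.filter_subset_filter _ (Finset.powerset_mono.2 h)) fun I _ _ => pow_nonneg hlam _

variable (Γ) in
lemma one_le_hardCoreZ (hlam : 0 ≤ lam) (A : Finset V) : 1 ≤ hardCoreZ Γ lam A :=
  (hardCoreZ_empty Γ).symm.le.trans (hardCoreZ_mono hlam A.empty_subset)

variable (Γ) in
lemma hardCoreZ_pos (hlam : 0 ≤ lam) (A : Finset V) : 0 < hardCoreZ Γ lam A :=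
  one_pos.trans_le (one_le_hardCoreZ Γ hlam A)

variable [DecidableEq V]

lemma hardCoreZ_le_mul_erase (hlam : 0 ≤ lam) (A : Finset V) (v : V) :
    hardCoreZ Γ lam A ≤ (1 + lam) * hardCoreZ Γ lam (A.erase v) := by
  classical
  by_cases hv : v ∈ A
  · rw [hardCoreZ_eq_erase_add_mul Γ hv, one_add_mul]
    have := hardCoreZ_mono hlam (Γ := Γ) (Finset.filter_subset (¬ Γ.Adj v ·) (A.erase v))
    gcongr
  · rw [Finset.erase_eq_of_notMem hv]
    exact le_mul_of_one_le_left (hardCoreZ_pos Γ hlam A).le (by linarith)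

lemma log_hardCoreZ_le_add_log_sdiff (hlam : 0 ≤ lam) (A S : Finset V) :
    Real.log (hardCoreZ Γ lam A) ≤
      Real.log (1 + lam) * S.card + Real.log (hardCoreZ Γ lam (A \ S)) := by
  induction S using Finset.induction_on with
  | empty => simp
  | insert v S hv ih =>
    have hstep := Real.log_le_log (hardCoreZ_pos Γ hlam _) (hardCoreZ_le_mul_erase hlam (A \ S) v)
    rw [Real.log_mul (by positivity) (hardCoreZ_pos Γ hlam _).ne'] at hstep
    rw [Finset.card_insert_of_notMem hv, Finset.sdiff_insert]
    push_cast
    linarith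

lemma hardCoreZ_union_le (hlam : 0 ≤ lam) {A B : Finset V} (h : Disjoint A B) :
    hardCoreZ Γ lam (A ∪ B) ≤ hardCoreZ Γ lam A * hardCoreZ Γ lam B := by
  classical
  induction A using Finset.strongInduction generalizing B with
  | H A ih =>
    obtain rfl | ⟨v, hv⟩ := A.eq_empty_or_nonempty
    · simp
    have herase : A.erase v ⊂ A := Finset.erase_ssubset hv
    have hfilter : (A.erase v).filter (¬ Γ.Adj v ·) ⊂ A :=
      (Finset.filter_subset _ _).trans_ssubset herase
    rw [hardCoreZ_eq_erase_add_mul Γ (Finset.mem_union_left B hv),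
      hardCoreZ_eq_erase_add_mul Γ hv, Finset.erase_union_distrib,
      Finset.erase_eq_of_notMem (Finset.disjoint_left.1 h hv), Finset.filter_union, add_mul,
      mul_assoc]
    gcongr
    · exact ih _ herase (h.mono_left herase.subset)
    · refine (ih _ hfilter (h.mono hfilter.subset (Finset.filter_subset _ _))).trans ?_
      gcongr
      · exact (hardCoreZ_pos Γ hlam _).le
      · exact hardCoreZ_mono hlam (Finset.filter_subset _ _)

lemma hardCoreZ_union_of_not_adj {A B : Finset V} (h : Disjoint A B)
    (hadj : ∀ a ∈ A, ∀ b ∈ B, ¬ Γ.Adj a b) :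
    hardCoreZ Γ lam (A ∪ B) = hardCoreZ Γ lam A * hardCoreZ Γ lam B := by
  classical
  induction A using Finset.strongInduction with
  | H A ih =>
    obtain rfl | ⟨v, hv⟩ := A.eq_empty_or_nonempty
    · simp
    have ih' {A' : Finset V} (hA' : A' ⊂ A) :=
      ih A' hA' (h.mono_left hA'.subset) fun a ha => hadj a (hA'.subset ha)
    have herase : A.erase v ⊂ A := Finset.erase_ssubset hv
    rw [hardCoreZ_eq_erase_add_mul Γ (Finset.mem_union_left B hv),
      hardCoreZ_eq_erase_add_mul Γ hv, Finset.erase_union_distrib,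
      Finset.erase_eq_of_notMem (Finset.disjoint_left.1 h hv), Finset.filter_union,
      Finset.filter_true_of_mem (s := B) (hadj v hv), ih' herase,
      ih' ((Finset.filter_subset _ _).trans_ssubset herase)]
    ring

/-- Removing the inner boundary of `A` decouples it from everything outside `A`. -/
lemma hardCoreZ_sdiff_innerBoundary_mul_le (hlam : 0 ≤ lam) {A B : Finset V} (h : Disjoint A B) :
    hardCoreZ Γ lam (A \ innerBoundary Γ A) * hardCoreZ Γ lam B ≤ hardCoreZ Γ lam (A ∪ B) := by
  rw [← hardCoreZ_union_of_not_adj (h.mono_left Finset.sdiff_subset)]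
  · exact hardCoreZ_mono hlam (Finset.union_subset_union_left Finset.sdiff_subset)
  · intro a ha b hb hadj
    have hbA : b ∉ A := Finset.disjoint_right.1 h hb
    rw [innerBoundary] at ha
    grind

variable {ι : Type*} {Q : ι → Finset V}

lemma log_hardCoreZ_biUnion_le (hlam : 0 ≤ lam) (hQ : Pairwise (Function.onFun Disjoint Q))
    (K : Finset ι) :
    Real.log (hardCoreZ Γ lam (K.biUnion Q)) ≤ ∑ k ∈ K, Real.log (hardCoreZ Γ lam (Q k)) := by
  classical
  induction K using Finset.induction_on with
  | empty => simp
  | insert k K hk ih =>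
    have hdisj : Disjoint (Q k) (K.biUnion Q) :=
      (Finset.disjoint_biUnion_right _ _ _).2 fun l hl => hQ (ne_of_mem_of_not_mem hl hk).symm
    rw [Finset.biUnion_insert, Finset.sum_insert hk]
    calc Real.log (hardCoreZ Γ lam (Q k ∪ K.biUnion Q))
        ≤ Real.log (hardCoreZ Γ lam (Q k) * hardCoreZ Γ lam (K.biUnion Q)) :=
          Real.log_le_log (hardCoreZ_pos Γ hlam _) (hardCoreZ_union_le hlam hdisj)
      _ = Real.log (hardCoreZ Γ lam (Q k)) + Real.log (hardCoreZ Γ lam (K.biUnion Q)) :=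
          Real.log_mul (hardCoreZ_pos Γ hlam _).ne' (hardCoreZ_pos Γ hlam _).ne'
      _ ≤ _ := by gcongr

lemma sum_sub_le_log_hardCoreZ_biUnion (hlam : 0 ≤ lam) (hQ : Pairwise (Function.onFun Disjoint Q))
    (K : Finset ι) :
    ∑ k ∈ K, (Real.log (hardCoreZ Γ lam (Q k)) -
        Real.log (1 + lam) * (innerBoundary Γ (Q k)).card) ≤
      Real.log (hardCoreZ Γ lam (K.biUnion Q)) := by
  classical
  induction K using Finset.induction_on with
  | empty => simp
  | insert k K hk ih =>
    have hdisj : Disjoint (Q k) (K.biUnion Q) :=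
      (Finset.disjoint_biUnion_right _ _ _).2 fun l hl => hQ (ne_of_mem_of_not_mem hl hk).symm
    rw [Finset.biUnion_insert, Finset.sum_insert hk]
    calc _ ≤ Real.log (hardCoreZ Γ lam (Q k \ innerBoundary Γ (Q k))) +
            Real.log (hardCoreZ Γ lam (K.biUnion Q)) :=
          add_le_add (sub_le_iff_le_add'.2 (log_hardCoreZ_le_add_log_sdiff hlam _ _)) ih
      _ = Real.log (hardCoreZ Γ lam (Q k \ innerBoundary Γ (Q k)) *
            hardCoreZ Γ lam (K.biUnion Q)) :=
          (Real.log_mul (hardCoreZ_pos Γ hlam _).ne' (hardCoreZ_pos Γ hlam _).ne').symm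
      _ ≤ Real.log (hardCoreZ Γ lam (Q k ∪ K.biUnion Q)) :=
          Real.log_le_log (mul_pos (hardCoreZ_pos Γ hlam _) (hardCoreZ_pos Γ hlam _))
            (hardCoreZ_sdiff_innerBoundary_mul_le hlam hdisj)

end PartitionFunction

section VacancyProb

variable {V W : Type*} [DecidableEq V] [DecidableEq W] (Γ : SimpleGraph V) {lam : ℝ}

/-- The probability that the vertex `v` is vacant in the hard-core model on the subgraph of `Γ`
induced by `A`. It equals `1` for `v ∉ A`. -/
noncomputable def vacancyProb (lam : ℝ) (A : Finset V) (v : V) : ℝ :=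
  hardCoreZ Γ lam (A.erase v) / hardCoreZ Γ lam A

lemma vacancyProb_pos (hlam : 0 ≤ lam) (A : Finset V) (v : V) : 0 < vacancyProb Γ lam A v :=
  div_pos (hardCoreZ_pos Γ hlam _) (hardCoreZ_pos Γ hlam _)

lemma vacancyProb_le_one (hlam : 0 ≤ lam) (A : Finset V) (v : V) : vacancyProb Γ lam A v ≤ 1 :=
  div_le_one_of_le₀ (hardCoreZ_mono hlam (A.erase_subset v)) (hardCoreZ_pos Γ hlam A).le

lemma inv_one_add_le_vacancyProb (hlam : 0 ≤ lam) (A : Finset V) (v : V) :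
    (1 + lam)⁻¹ ≤ vacancyProb Γ lam A v := by
  rw [vacancyProb, le_div_iff₀ (hardCoreZ_pos Γ hlam A), inv_mul_le_iff₀ (by positivity)]
  exact hardCoreZ_le_mul_erase hlam A v

lemma vacancyProb_map {Γ' : SimpleGraph W} (f : Γ ↪g Γ') (A : Finset V) (v : V) :
    vacancyProb Γ' lam (A.map f.toEmbedding) (f v) = vacancyProb Γ lam A v := by
  have herase : (A.map f.toEmbedding).erase (f v) = (A.erase v).map f.toEmbedding :=
    (Finset.map_erase f.toEmbedding A v).symm
  rw [vacancyProb, herase, hardCoreZ_map, hardCoreZ_map, vacancyProb]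

lemma prod_vacancyProb (hlam : 0 ≤ lam) (l : List V) (A : Finset V) :
    ∏ i : Fin l.length, vacancyProb Γ lam (A \ (l.take i).toFinset) (l.get i) =
      hardCoreZ Γ lam (A \ l.toFinset) / hardCoreZ Γ lam A := by
  induction l generalizing A with
  | nil => simp [(hardCoreZ_pos Γ hlam A).ne']
  | cons v l ih =>
    have hsdiff (B : Finset V) : A \ insert v B = A.erase v \ B := by
      rw [Finset.sdiff_insert, Finset.erase_sdiff_comm]
    simp only [List.length_cons, Fin.prod_univ_succ, Fin.val_zero, List.take_zero,
      List.toFinset_nil, Finset.sdiff_empty, List.get_cons_zero, Fin.val_succ,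
      List.take_succ_cons, List.toFinset_cons, hsdiff, List.get_cons_succ', ih]
    rw [vacancyProb, mul_comm, div_mul_div_cancel₀ (hardCoreZ_pos Γ hlam _).ne']

lemma vacancyProb_eq_inv (hlam : 0 ≤ lam) {A : Finset V} {v : V} (hv : v ∈ A) {l : List V}
    (hl : ∀ u, u ∈ l ↔ u ∈ A ∧ Γ.Adj v u) :
    vacancyProb Γ lam A v =
      (1 + lam * ∏ i : Fin l.length,
        vacancyProb Γ lam (A.erase v \ (l.take i).toFinset) (l.get i))⁻¹ := by
  classical
  have hnbr : A.erase v \ l.toFinset = (A.erase v).filter (¬ Γ.Adj v ·) := by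
    ext u
    simp only [Finset.mem_sdiff, List.mem_toFinset, Finset.mem_filter, hl]
    grind
  have hpos := hardCoreZ_pos Γ hlam (A.erase v)
  rw [prod_vacancyProb Γ hlam, hnbr, vacancyProb, hardCoreZ_eq_erase_add_mul Γ hv, mul_div_assoc',
    one_add_div hpos.ne', inv_div]

end VacancyProb

section CavityBounds

variable {V : Type*} [DecidableEq V] {lam : ℝ} {e : Finset V → V → List V}

/-- The iterate of depth `t` of the cavity recursion that bounds vacancy probabilities from below:
each step reverses inequalities, so it starts from `0` for even `t` and from `1` for odd `t`. -/
noncomputable def cavityLower (lam : ℝ) (e : Finset V → V → List V) (t : ℕ) : Finset V → V → ℝ :=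
  cavityRec lam (if Even t then 0 else 1) e t

/-- The iterate of depth `t` of the cavity recursion that bounds vacancy probabilities from above,
with the initial values of `cavityLower` exchanged. -/
noncomputable def cavityUpper (lam : ℝ) (e : Finset V → V → List V) (t : ℕ) : Finset V → V → ℝ :=
  cavityRec lam (if Even t then 1 else 0) e t

lemma cavityLower_succ (t : ℕ) (A : Finset V) (v : V) :
    cavityLower lam e (t + 1) A v =
      (1 + lam * ∏ i : Fin (e A v).length,
        cavityUpper lam e t (A.erase v \ ((e A v).take i).toFinset) ((e A v).get i))⁻¹ := by
  simp only [cavityLower, cavityUpper, cavityRec, Nat.even_add_one, ite_not]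

lemma cavityUpper_succ (t : ℕ) (A : Finset V) (v : V) :
    cavityUpper lam e (t + 1) A v =
      (1 + lam * ∏ i : Fin (e A v).length,
        cavityLower lam e t (A.erase v \ ((e A v).take i).toFinset) ((e A v).get i))⁻¹ := by
  simp only [cavityLower, cavityUpper, cavityRec, Nat.even_add_one, ite_not]

lemma cavityRec_nonneg (hlam : 0 ≤ lam) {x₀ : ℝ} (hx₀ : 0 ≤ x₀) (t : ℕ) (A : Finset V) (v : V) :
    0 ≤ cavityRec lam x₀ e t A v := by
  induction t generalizing A v with
  | zero => exact hx₀
  | succ t ih =>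
    rw [cavityRec]
    exact inv_nonneg.2
      (add_nonneg zero_le_one (mul_nonneg hlam (Finset.prod_nonneg fun i _ => ih _ _)))

lemma cavityLower_nonneg (hlam : 0 ≤ lam) (t : ℕ) (A : Finset V) (v : V) :
    0 ≤ cavityLower lam e t A v :=
  cavityRec_nonneg hlam (by split_ifs <;> norm_num) t A v

lemma inv_one_add_mul_prod_anti {ι : Type*} [Fintype ι] (hlam : 0 ≤ lam) {f g : ι → ℝ}
    (hf : ∀ i, 0 ≤ f i) (hfg : ∀ i, f i ≤ g i) :
    (1 + lam * ∏ i, g i)⁻¹ ≤ (1 + lam * ∏ i, f i)⁻¹ := by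
  have hprod : 0 ≤ ∏ i, f i := Finset.prod_nonneg fun i _ => hf i
  have hle : ∏ i, f i ≤ ∏ i, g i := Finset.prod_le_prod (fun i _ => hf i) fun i _ => hfg i
  gcongr

lemma get_notMem_take_of_nodup {α : Type*} {l : List α} (hl : l.Nodup) (i : Fin l.length) :
    l.get i ∉ l.take i := by
  simp only [List.mem_take_iff_getElem, List.get_eq_getElem, hl.getElem_inj_iff]
  grind

variable {Γ : SimpleGraph V}

/-- The recursion of depth `t` at `v` only explores vertices at distance at most `t`, so `A` may be
replaced by any set that agrees with it there. -/
theorem vacancyProb_mem_Icc_cavity (hlam : 0 ≤ lam) (he : IsNbrEnum Γ e) {t : ℕ}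
    {A A' : Finset V} {v : V} (hv : v ∈ A)
    (hAA' : ∀ u, Γ.edist v u ≤ t → (u ∈ A ↔ u ∈ A')) :
    vacancyProb Γ lam A' v ∈ Set.Icc (cavityLower lam e t A v) (cavityUpper lam e t A v) := by
  induction t generalizing A A' v with
  | zero =>
    simpa [cavityLower, cavityUpper, cavityRec] using
      And.intro (vacancyProb_pos Γ hlam A' v).le (vacancyProb_le_one Γ hlam A' v)
  | succ t ih =>
    obtain ⟨hnodup, hmem⟩ := he A v hv
    set l := e A v
    have hnbr (u : V) : u ∈ l ↔ u ∈ A' ∧ Γ.Adj v u := by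
      rw [hmem, and_congr_left_iff]
      intro huv
      exact hAA' u ((SimpleGraph.edist_eq_one_iff_adj.2 huv).le.trans (by simp))
    have hbounds (i : Fin l.length) :
        vacancyProb Γ lam (A'.erase v \ (l.take i).toFinset) (l.get i) ∈
          Set.Icc (cavityLower lam e t (A.erase v \ (l.take i).toFinset) (l.get i))
            (cavityUpper lam e t (A.erase v \ (l.take i).toFinset) (l.get i)) := by
      obtain ⟨hiA, hadj⟩ := (hmem _).1 (l.get_mem i)
      refine ih ?_ fun u hu => ?_
      · exact Finset.mem_sdiff.2 ⟨Finset.mem_erase.2 ⟨hadj.ne', hiA⟩,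
          List.mem_toFinset.not.2 (get_notMem_take_of_nodup hnodup i)⟩
      · have hvu : Γ.edist v u ≤ (t + 1 : ℕ) :=
          calc Γ.edist v u ≤ Γ.edist v (l.get i) + Γ.edist (l.get i) u :=
                SimpleGraph.edist_triangle
            _ ≤ 1 + t := add_le_add (SimpleGraph.edist_eq_one_iff_adj.2 hadj).le hu
            _ = (t + 1 : ℕ) := by push_cast; exact add_comm _ _
        simp only [Finset.mem_sdiff, Finset.mem_erase, hAA' u hvu]
    have hv' : v ∈ A' := (hAA' v (by simp)).1 hv
    rw [vacancyProb_eq_inv Γ hlam hv' hnbr, cavityLower_succ, cavityUpper_succ]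
    exact ⟨inv_one_add_mul_prod_anti hlam (fun i => (vacancyProb_pos Γ hlam _ _).le)
        fun i => (hbounds i).2,
      inv_one_add_mul_prod_anti hlam (fun i => cavityLower_nonneg hlam _ _ _)
        fun i => (hbounds i).1⟩

end CavityBounds

section ChainRule

variable {V : Type*} {r : V → V → Prop}

open Classical in
/-- The part of `A` that weakly precedes `v` in the strict order `r`: what is left of `A` when its
vertices are removed in decreasing order until `v` is the next one. -/
noncomputable def initialSegment (r : V → V → Prop) (A : Finset V) (v : V) : Finset V :=
  A.filter fun u => r u v ∨ u = v

lemma mem_initialSegment {A : Finset V} {u v : V} :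
    u ∈ initialSegment r A v ↔ u ∈ A ∧ (r u v ∨ u = v) := by
  simp [initialSegment]

variable [DecidableEq V] [IsStrictTotalOrder V r] (Γ : SimpleGraph V) {lam : ℝ}

variable (r) in
lemma log_hardCoreZ_eq_sum (hlam : 0 ≤ lam) (A : Finset V) :
    Real.log (hardCoreZ Γ lam A) =
      ∑ v ∈ A, -Real.log (vacancyProb Γ lam (initialSegment r A v) v) := by
  classical
  let := linearOrderOfSTO r
  induction A using Finset.induction_on_max with
  | empty => simp
  | insert a s hs ih =>
    have ha : a ∉ s := fun h => lt_irrefl _ (hs a h)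
    have hmax : initialSegment r (insert a s) a = insert a s := by
      ext u
      rw [mem_initialSegment, and_iff_left_iff_imp, Finset.mem_insert]
      exact fun hu => hu.symm.imp (hs u) id
    have hbelow : ∀ v ∈ s, initialSegment r (insert a s) v = initialSegment r s v := fun v hv => by
      have hav : ¬ (r a v ∨ a = v) := by
        rintro (h | rfl)
        exacts [lt_asymm (α := V) h (hs v hv), ha hv]
      ext u
      simp only [mem_initialSegment, Finset.mem_insert]
      grind
    have herase : (insert a s).erase a = s := Finset.erase_insert ha
    rw [Finset.sum_insert ha, hmax, Finset.sum_congr rfl fun v hv => by rw [hbelow v hv], ← ih,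
      vacancyProb, herase,
      Real.log_div (hardCoreZ_pos Γ hlam _).ne' (hardCoreZ_pos Γ hlam _).ne']
    ring

variable {Γ} {A S : Finset V} {x : ℝ}

lemma le_log_hardCoreZ_of_vacancyProb_le (hlam : 0 ≤ lam) (hS : S ⊆ A)
    (hx : ∀ v ∈ A \ S, vacancyProb Γ lam (initialSegment r A v) v ≤ x) :
    -Real.log x * A.card + Real.log x * S.card ≤ Real.log (hardCoreZ Γ lam A) := by
  rw [log_hardCoreZ_eq_sum r Γ hlam, ← Finset.sum_sdiff hS]
  have hsdiff : (A \ S).card • -Real.log x ≤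
      ∑ v ∈ A \ S, -Real.log (vacancyProb Γ lam (initialSegment r A v) v) :=
    Finset.card_nsmul_le_sum _ _ _ fun v hv =>
      neg_le_neg (Real.log_le_log (vacancyProb_pos Γ hlam _ _) (hx v hv))
  have hrest : 0 ≤ ∑ v ∈ S, -Real.log (vacancyProb Γ lam (initialSegment r A v) v) :=
    Finset.sum_nonneg fun v _ => neg_nonneg.2
      (Real.log_nonpos (vacancyProb_pos Γ hlam _ _).le (vacancyProb_le_one Γ hlam _ _))
  rw [nsmul_eq_mul, Finset.cast_card_sdiff hS] at hsdiff
  linarith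

lemma log_hardCoreZ_le_of_le_vacancyProb (hlam : 0 ≤ lam) (hS : S ⊆ A) (hx₀ : 0 < x)
    (hx : ∀ v ∈ A \ S, x ≤ vacancyProb Γ lam (initialSegment r A v) v) :
    Real.log (hardCoreZ Γ lam A) ≤
      -Real.log x * A.card + (Real.log (1 + lam) + Real.log x) * S.card := by
  rw [log_hardCoreZ_eq_sum r Γ hlam, ← Finset.sum_sdiff hS]
  have hsdiff : ∑ v ∈ A \ S, -Real.log (vacancyProb Γ lam (initialSegment r A v) v) ≤
      (A \ S).card • -Real.log x :=
    Finset.sum_le_card_nsmul _ _ _ fun v hv => neg_le_neg (Real.log_le_log hx₀ (hx v hv))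
  have hrest : ∑ v ∈ S, -Real.log (vacancyProb Γ lam (initialSegment r A v) v) ≤
      S.card • Real.log (1 + lam) :=
    Finset.sum_le_card_nsmul _ _ _ fun v _ => by
      rw [neg_le, ← Real.log_inv]
      exact Real.log_le_log (by positivity) (inv_one_add_le_vacancyProb Γ hlam _ _)
  rw [nsmul_eq_mul, Finset.cast_card_sdiff hS] at hsdiff
  rw [nsmul_eq_mul] at hrest
  linarith

end ChainRule

section Collar

variable {V : Type*} {Γ : SimpleGraph V}

open Classical in
/-- The points of `A` within graph distance `r` of the complement of `A`. -/
noncomputable def collar (Γ : SimpleGraph V) (r : ℕ) (A : Finset V) : Finset V :=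
  A.filter fun v => ∃ u ∉ A, Γ.edist v u ≤ r

lemma mem_collar {r : ℕ} {A : Finset V} {v : V} :
    v ∈ collar Γ r A ↔ v ∈ A ∧ ∃ u ∉ A, Γ.edist v u ≤ r := by
  simp [collar]

lemma collar_subset (r : ℕ) (A : Finset V) : collar Γ r A ⊆ A :=
  fun _ hv => (mem_collar.1 hv).1

lemma mem_of_edist_le_of_notMem_collar {r : ℕ} {A : Finset V} {u v : V} (hv : v ∈ A)
    (hv' : v ∉ collar Γ r A) (huv : Γ.edist v u ≤ r) : u ∈ A :=
  by_contra fun hu => hv' (mem_collar.2 ⟨hv, u, hu, huv⟩)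

/-- Walk from `v` to a point outside `A` until the first exit from `A`. -/
lemma exists_mem_innerBoundary_of_mem_collar {r : ℕ} {A : Finset V} {v : V}
    (hv : v ∈ collar Γ r A) : ∃ w ∈ innerBoundary Γ A, Γ.edist v w ≤ r := by
  classical
  obtain ⟨hvA, u, huA, hvu⟩ := mem_collar.1 hv
  obtain ⟨p, hp⟩ := SimpleGraph.exists_walk_of_edist_ne_top
    (ne_top_of_le_ne_top (ENat.natCast_ne_top r) hvu)
  obtain ⟨e, he, hfst, hsnd⟩ := p.exists_boundary_dart A hvA huA
  have hw := p.dart_fst_mem_support_of_mem_darts he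
  refine ⟨e.fst, Finset.mem_filter.2 ⟨hfst, e.snd, e.adj, hsnd⟩, ?_⟩
  calc Γ.edist v e.fst ≤ (p.takeUntil _ hw).length := SimpleGraph.edist_le _
    _ ≤ p.length := by exact_mod_cast p.length_takeUntil_le_length hw
    _ ≤ r := hp.trans_le hvu

end Collar

section LatticeGeometry

variable {d : ℕ}

lemma exists_adj_sum_abs_sub_add_one {v u : Fin d → ℤ} (h : v ≠ u) :
    ∃ w, (latticeGraph d).Adj w u ∧ ∑ j, |v j - w j| + 1 = ∑ j, |v j - u j| := by
  obtain ⟨k, hk⟩ := Function.ne_iff.1 h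
  obtain ⟨s, hs, hsk⟩ : ∃ s : ℤ, |s| = 1 ∧ |v k - u k| = |v k - (u k + s)| + 1 := by
    rcases lt_or_gt_of_ne hk with hlt | hgt
    · exact ⟨-1, by grind⟩
    · exact ⟨1, by grind⟩
  let w : Fin d → ℤ := u + Pi.single k s
  have hwu (j : Fin d) : |w j - u j| = (Pi.single k 1 : Fin d → ℤ) j := by
    obtain rfl | hj := eq_or_ne j k
    · simp [w, hs]
    · simp [w, hj]
  have hvw (j : Fin d) : |v j - u j| = |v j - w j| + (Pi.single k 1 : Fin d → ℤ) j := by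
    obtain rfl | hj := eq_or_ne j k
    · simpa [w] using hsk
    · simp [w, hj]
  refine ⟨w, ?_, ?_⟩
  · simp only [latticeGraph, hwu, Fintype.sum_pi_single']
  · simp only [hvw, Finset.sum_add_distrib, Fintype.sum_pi_single']

lemma sum_abs_sub_le_length {v u : Fin d → ℤ} (p : (latticeGraph d).Walk v u) :
    ∑ j, |v j - u j| ≤ p.length := by
  induction p with
  | nil => simp
  | @cons v w u hvw p ih =>
    calc ∑ j, |v j - u j| ≤ ∑ j, (|v j - w j| + |w j - u j|) :=
          Finset.sum_le_sum fun j _ => abs_sub_le _ _ _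
      _ = 1 + ∑ j, |w j - u j| := by rw [Finset.sum_add_distrib, hvw]
      _ ≤ (p.cons hvw).length := by rw [SimpleGraph.Walk.length_cons]; push_cast; linarith

lemma edist_latticeGraph_le_iff {v u : Fin d → ℤ} {r : ℕ} :
    (latticeGraph d).edist v u ≤ r ↔ ∑ j, |v j - u j| ≤ r := by
  constructor
  · intro h
    obtain ⟨p, hp⟩ := SimpleGraph.exists_walk_of_edist_ne_top
      (ne_top_of_le_ne_top (ENat.natCast_ne_top r) h)
    exact (sum_abs_sub_le_length p).trans (by exact_mod_cast hp.trans_le h)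
  · intro h
    induction r generalizing u with
    | zero =>
      have hvu : v = u := funext fun j => sub_eq_zero.1 <| abs_eq_zero.1 <|
        (Finset.sum_eq_zero_iff_of_nonneg fun j _ => abs_nonneg (v j - u j)).1
          (h.antisymm (Finset.sum_nonneg fun j _ => abs_nonneg _)) j (Finset.mem_univ j)
      simp [hvu]
    | succ r ih =>
      obtain rfl | hvu := eq_or_ne v u
      · simp
      obtain ⟨w, hadj, hw⟩ := exists_adj_sum_abs_sub_add_one hvu
      calc (latticeGraph d).edist v u
          ≤ (latticeGraph d).edist v w + (latticeGraph d).edist w u := SimpleGraph.edist_triangle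
        _ ≤ r + 1 := add_le_add (ih (by push_cast at h; linarith))
            (SimpleGraph.edist_eq_one_iff_adj.2 hadj).le

lemma mem_latticeBall {r : ℕ} {v : Fin d → ℤ} : v ∈ latticeBall d r ↔ ∑ j, |v j| ≤ (r : ℤ) := by
  simp only [latticeBall, Finset.mem_filter, Fintype.mem_piFinset, Finset.mem_Icc, ← abs_le,
    and_iff_right_iff_imp]
  exact fun h j => (Finset.single_le_sum (fun i _ => abs_nonneg (v i)) (Finset.mem_univ j)).trans h

lemma halfBall_eq_initialSegment (n : ℕ) :
    halfBall d n = initialSegment LexPrec (latticeBall d n) 0 := by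
  ext v
  simp [halfBall, mem_initialSegment]

lemma zero_mem_halfBall (d n : ℕ) : 0 ∈ halfBall d n := by
  simp [halfBall_eq_initialSegment, mem_initialSegment, mem_latticeBall]

lemma lexPrec_add_self_iff {u v : Fin d → ℤ} : LexPrec (u + v) v ↔ LexPrec u 0 := by
  simp [LexPrec]

lemma lexPrec_iff_toColex_lt {v u : Fin d → ℤ} : LexPrec v u ↔ toColex v < toColex u :=
  exists_congr fun _ => and_comm

instance : IsStrictTotalOrder (Fin d → ℤ) LexPrec where
  irrefl v h := lt_irrefl (toColex v) (lexPrec_iff_toColex_lt.1 h)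
  trans _ _ _ h h' := lexPrec_iff_toColex_lt.2
    (lt_trans (lexPrec_iff_toColex_lt.1 h) (lexPrec_iff_toColex_lt.1 h'))
  trichotomous _ _ h h' := toColex_inj.1
    (le_antisymm (not_lt.1 (mt lexPrec_iff_toColex_lt.2 h'))
      (not_lt.1 (mt lexPrec_iff_toColex_lt.2 h)))

/-- Translation by `w`, as an embedding of the lattice graph into itself. -/
def latticeShift (w : Fin d → ℤ) : latticeGraph d ↪g latticeGraph d where
  toEmbedding := addRightEmbedding w
  map_rel_iff' := by simp [latticeGraph]

@[simp] lemma latticeShift_apply (w v : Fin d → ℤ) : latticeShift w v = v + w := rfl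

lemma mem_map_latticeShift {w u : Fin d → ℤ} {A : Finset (Fin d → ℤ)} :
    u ∈ A.map (latticeShift w).toEmbedding ↔ u - w ∈ A := by
  simp [latticeShift, ← eq_sub_iff_add_eq]

lemma card_collar_le (r : ℕ) (Λ : Finset (Fin d → ℤ)) :
    (collar (latticeGraph d) r Λ).card ≤
      (innerBoundary (latticeGraph d) Λ).card * (latticeBall d r).card := by
  classical
  have hsub : collar (latticeGraph d) r Λ ⊆ (innerBoundary (latticeGraph d) Λ).biUnion fun w =>
      (latticeBall d r).map (latticeShift w).toEmbedding := by
    intro v hv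
    obtain ⟨w, hw, hvw⟩ := exists_mem_innerBoundary_of_mem_collar hv
    exact Finset.mem_biUnion.2 ⟨w, hw, mem_map_latticeShift.2
      (mem_latticeBall.2 (edist_latticeGraph_le_iff.1 hvw))⟩
  exact (Finset.card_le_card hsub).trans
    (Finset.card_biUnion_le_card_mul _ _ _ fun w _ => (Finset.card_map _).le)

variable {Λ : ℕ → Finset (Fin d → ℤ)}

lemma IsExhaustion.card_pos (h : IsExhaustion d Λ) (n : ℕ) : 0 < (Λ n).card :=
  Finset.card_pos.2 ⟨0, h.mono n.zero_le h.zero_mem⟩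

lemma IsExhaustion.tendsto_card_collar_div (h : IsExhaustion d Λ) (r : ℕ) :
    Filter.Tendsto (fun n => ((collar (latticeGraph d) r (Λ n)).card : ℝ) / (Λ n).card)
      Filter.atTop (nhds 0) := by
  have hlim := h.boundary.mul_const ((latticeBall d r).card : ℝ)
  rw [zero_mul] at hlim
  refine squeeze_zero (fun n => by positivity) (fun n => ?_) hlim
  rw [div_mul_eq_mul_div]
  gcongr
  exact_mod_cast card_collar_le r (Λ n)

lemma IsExhaustion.tendsto_mul_card_add_mul_card_collar_div (h : IsExhaustion d Λ) (r : ℕ)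
    (a C : ℝ) :
    Filter.Tendsto (fun n =>
      (a * (Λ n).card + C * (collar (latticeGraph d) r (Λ n)).card) / ((Λ n).card : ℝ))
      Filter.atTop (nhds a) := by
  have hlim := ((h.tendsto_card_collar_div r).const_mul C).const_add a
  rw [mul_zero, add_zero] at hlim
  refine hlim.congr fun n => ?_
  have hcard : ((Λ n).card : ℝ) ≠ 0 := by exact_mod_cast (h.card_pos n).ne'
  field_simp

end LatticeGeometry

section LatticeCube

variable {d : ℕ}

/-- The cube of side `m` in `ℤ^d` whose coordinatewise smallest point is `a`. -/
noncomputable def latticeCube (a : Fin d → ℤ) (m : ℕ) : Finset (Fin d → ℤ) :=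
  Fintype.piFinset fun j => Finset.Ico (a j) (a j + m)

lemma mem_latticeCube {a v : Fin d → ℤ} {m : ℕ} :
    v ∈ latticeCube a m ↔ ∀ j, a j ≤ v j ∧ v j < a j + m := by
  simp only [latticeCube, Fintype.mem_piFinset, Finset.mem_Ico]

@[simp] lemma card_latticeCube (a : Fin d → ℤ) (m : ℕ) : (latticeCube a m).card = m ^ d := by
  simp [latticeCube]

lemma map_latticeShift_latticeCube (a : Fin d → ℤ) (m : ℕ) :
    (latticeCube 0 m).map (latticeShift a).toEmbedding = latticeCube a m := by
  ext v
  simp only [mem_map_latticeShift, mem_latticeCube, Pi.sub_apply, Pi.zero_apply, sub_nonneg,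
    sub_lt_iff_lt_add']
  simp

lemma abs_sub_le_one_of_adj {v u : Fin d → ℤ} (h : (latticeGraph d).Adj v u) (j : Fin d) :
    |v j - u j| ≤ 1 :=
  h ▸ Finset.single_le_sum (fun i _ => abs_nonneg (v i - u i)) (Finset.mem_univ j)

lemma card_innerBoundary_latticeCube_add_le (a : Fin d → ℤ) (m : ℕ) :
    (innerBoundary (latticeGraph d) (latticeCube a (m + 2))).card + m ^ d ≤ (m + 2) ^ d := by
  classical
  have hsub : latticeCube (a + 1) m ⊆ latticeCube a (m + 2) := fun v hv => by
    simp only [mem_latticeCube, Pi.add_apply, Pi.one_apply] at hv ⊢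
    exact fun j => by grind
  have hdisj : Disjoint (innerBoundary (latticeGraph d) (latticeCube a (m + 2)))
      (latticeCube (a + 1) m) := by
    refine Finset.disjoint_left.2 fun v hv hvm => ?_
    obtain ⟨-, u, hvu, hu⟩ := Finset.mem_filter.1 hv
    refine hu (mem_latticeCube.2 fun j => ?_)
    have hvj := mem_latticeCube.1 hvm j
    have habs := abs_le.1 (abs_sub_le_one_of_adj hvu j)
    simp only [Pi.add_apply, Pi.one_apply] at hvj
    grind
  rw [← card_latticeCube (a + 1) m, ← Finset.card_union_of_disjoint hdisj,
    ← card_latticeCube a (m + 2)]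
  exact Finset.card_le_card (Finset.union_subset (Finset.filter_subset _ _) hsub)

lemma card_innerBoundary_latticeCube_le (a : Fin d → ℤ) (m : ℕ) :
    ((innerBoundary (latticeGraph d) (latticeCube a (m + 2))).card : ℝ) ≤
      (1 - ((m : ℝ) / (m + 2)) ^ d) * ((m : ℝ) + 2) ^ d := by
  have hcard := card_innerBoundary_latticeCube_add_le a m
  rw [sub_mul, one_mul, ← mul_pow, div_mul_cancel₀ _ (by positivity), le_sub_iff_add_le]
  exact_mod_cast hcard

lemma tendsto_one_sub_div_add_two_pow (d : ℕ) :
    Filter.Tendsto (fun m : ℕ => 1 - ((m : ℝ) / (m + 2)) ^ d) Filter.atTop (nhds 0) := by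
  simpa using ((tendsto_natCast_div_add_atTop (2 : ℝ)).pow d).const_sub 1

lemma isExhaustion_latticeCube (d : ℕ) :
    IsExhaustion d fun n => latticeCube (fun _ => -(n + 1 : ℤ)) (2 * n + 2) where
  zero_mem := mem_latticeCube.2 fun j => by simp
  mono n m hnm v hv := by
    simp only [mem_latticeCube] at hv ⊢
    exact fun j => by grind
  ball_subset r := by
    filter_upwards [Filter.eventually_ge_atTop r] with n hn v hv
    refine mem_latticeCube.2 fun j => ?_
    have hvj : |v j| ≤ r := (Finset.single_le_sum (fun i _ => abs_nonneg (v i))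
      (Finset.mem_univ j)).trans (mem_latticeBall.1 hv)
    have := abs_le.1 hvj
    grind
  boundary := by
    refine squeeze_zero (fun n => by positivity) (fun n => ?_)
      ((tendsto_one_sub_div_add_two_pow d).comp
        (Filter.tendsto_id.const_mul_atTop' (zero_lt_two (α := ℕ))))
    rw [div_le_iff₀ (by rw [card_latticeCube]; positivity)]
    simpa using card_innerBoundary_latticeCube_le (fun _ => -(n + 1 : ℤ)) (2 * n)

end LatticeCube

section Tiling

variable {d L : ℕ}

lemma mem_latticeCube_nsmul_iff (hL : 0 < L) {k v : Fin d → ℤ} :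
    v ∈ latticeCube (L • k) L ↔ (fun j => v j / (L : ℤ)) = k := by
  have hL' : (0 : ℤ) < L := by exact_mod_cast hL
  simp only [mem_latticeCube, funext_iff, Int.ediv_eq_iff_of_pos hL', nsmul_eq_mul, Pi.mul_apply,
    Pi.natCast_apply, mul_comm]

lemma pairwise_disjoint_latticeCube_nsmul (d : ℕ) (hL : 0 < L) :
    Pairwise (Function.onFun Disjoint fun k : Fin d → ℤ => latticeCube (L • k) L) :=
  fun _ _ hkl => Finset.disjoint_left.2 fun _ hv hv' => hkl <|
    ((mem_latticeCube_nsmul_iff hL).1 hv).symm.trans ((mem_latticeCube_nsmul_iff hL).1 hv')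

lemma card_biUnion_latticeCube_nsmul (hL : 0 < L) (K : Finset (Fin d → ℤ)) :
    (K.biUnion fun k => latticeCube (L • k) L).card = K.card * L ^ d := by
  rw [Finset.card_biUnion ((pairwise_disjoint_latticeCube_nsmul d hL).set_pairwise _)]
  simp only [card_latticeCube, Finset.sum_const, smul_eq_mul]

lemma edist_le_of_mem_latticeCube {a v u : Fin d → ℤ} (hv : v ∈ latticeCube a L)
    (hu : u ∈ latticeCube a L) : (latticeGraph d).edist v u ≤ (d * L : ℕ) := by
  rw [edist_latticeGraph_le_iff]
  have hj : ∀ j ∈ Finset.univ, |v j - u j| ≤ L := fun j _ => by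
    have := mem_latticeCube.1 hv j
    have := mem_latticeCube.1 hu j
    grind
  simpa using Finset.sum_le_card_nsmul _ _ _ hj

lemma exists_biUnion_latticeCube_subset (hL : 0 < L) (Λ : Finset (Fin d → ℤ)) :
    ∃ K : Finset (Fin d → ℤ), (K.biUnion fun k => latticeCube (L • k) L) ⊆ Λ ∧
      Λ \ (K.biUnion fun k => latticeCube (L • k) L) ⊆ collar (latticeGraph d) (d * L) Λ := by
  classical
  refine ⟨(Λ.image fun v j => v j / (L : ℤ)).filter fun k => latticeCube (L • k) L ⊆ Λ,
    Finset.biUnion_subset.2 fun k hk => (Finset.mem_filter.1 hk).2, fun v hv => ?_⟩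
  obtain ⟨hvΛ, hvK⟩ := Finset.mem_sdiff.1 hv
  have hvcube := (mem_latticeCube_nsmul_iff hL).2 (rfl : (fun j => v j / (L : ℤ)) = _)
  have hnot : ¬ latticeCube (L • fun j => v j / (L : ℤ)) L ⊆ Λ := fun hsub =>
    hvK (Finset.mem_biUnion.2
      ⟨_, Finset.mem_filter.2 ⟨Finset.mem_image_of_mem _ hvΛ, hsub⟩, hvcube⟩)
  obtain ⟨u, hu, huΛ⟩ := Finset.not_subset.1 hnot
  exact mem_collar.2 ⟨hvΛ, u, huΛ, edist_le_of_mem_latticeCube hvcube hu⟩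

end Tiling

section FreeEnergy

variable {d : ℕ} {lam : ℝ}

/-- The free energy per site of the hard-core model on a cube of side `L`. -/
noncomputable def cubeFreeEnergy (d : ℕ) (lam : ℝ) (L : ℕ) : ℝ :=
  Real.log (hardCoreZ (latticeGraph d) lam (latticeCube 0 L)) / (L : ℝ) ^ d

lemma cubeFreeEnergy_nonneg (d : ℕ) (hlam : 0 ≤ lam) (L : ℕ) : 0 ≤ cubeFreeEnergy d lam L :=
  div_nonneg (Real.log_nonneg (one_le_hardCoreZ _ hlam _)) (by positivity)

lemma log_hardCoreZ_latticeCube {L : ℕ} (hL : 0 < L) (a : Fin d → ℤ) :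
    Real.log (hardCoreZ (latticeGraph d) lam (latticeCube a L)) =
      cubeFreeEnergy d lam L * (L : ℝ) ^ d := by
  rw [← map_latticeShift_latticeCube, hardCoreZ_map, cubeFreeEnergy,
    div_mul_cancel₀ _ (by positivity)]

lemma log_hardCoreZ_le_cubeFreeEnergy (hlam : 0 ≤ lam) {L : ℕ} (hL : 0 < L)
    (Λ : Finset (Fin d → ℤ)) :
    Real.log (hardCoreZ (latticeGraph d) lam Λ) ≤ cubeFreeEnergy d lam L * Λ.card +
      Real.log (1 + lam) * (collar (latticeGraph d) (d * L) Λ).card := by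
  obtain ⟨K, hsub, hcollar⟩ := exists_biUnion_latticeCube_subset hL Λ
  set U := K.biUnion fun k => latticeCube (L • k) L
  have hdisj := pairwise_disjoint_latticeCube_nsmul d hL
  have hcard : (U.card : ℝ) = K.card * (L : ℝ) ^ d := by
    exact_mod_cast card_biUnion_latticeCube_nsmul hL K
  have hlog := Real.log_nonneg (le_add_of_nonneg_right hlam)
  have hf := cubeFreeEnergy_nonneg d hlam L
  calc Real.log (hardCoreZ (latticeGraph d) lam Λ)
      ≤ Real.log (1 + lam) * (Λ \ U).card +
          Real.log (hardCoreZ (latticeGraph d) lam (Λ \ (Λ \ U))) :=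
        log_hardCoreZ_le_add_log_sdiff hlam Λ (Λ \ U)
    _ ≤ Real.log (1 + lam) * (collar (latticeGraph d) (d * L) Λ).card +
          ∑ k ∈ K, Real.log (hardCoreZ (latticeGraph d) lam (latticeCube (L • k) L)) := by
        rw [Finset.sdiff_sdiff_eq_self hsub]
        gcongr
        exact log_hardCoreZ_biUnion_le hlam hdisj K
    _ = Real.log (1 + lam) * (collar (latticeGraph d) (d * L) Λ).card +
          cubeFreeEnergy d lam L * U.card := by
        simp only [log_hardCoreZ_latticeCube hL, Finset.sum_const, nsmul_eq_mul, hcard]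
        ring
    _ ≤ _ := by
        rw [add_comm]
        gcongr

lemma cubeFreeEnergy_sub_mul_le_log_hardCoreZ_latticeCube (hlam : 0 ≤ lam) (m : ℕ)
    (a : Fin d → ℤ) :
    (cubeFreeEnergy d lam (m + 2) - Real.log (1 + lam) * (1 - ((m : ℝ) / (m + 2)) ^ d)) *
        ((m : ℝ) + 2) ^ d ≤
      Real.log (hardCoreZ (latticeGraph d) lam (latticeCube a (m + 2))) -
        Real.log (1 + lam) *
          (innerBoundary (latticeGraph d) (latticeCube a (m + 2))).card := by
  have hboundary := mul_le_mul_of_nonneg_left (card_innerBoundary_latticeCube_le a m)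
    (Real.log_nonneg (le_add_of_nonneg_right hlam))
  rw [log_hardCoreZ_latticeCube (by omega)]
  push_cast
  linarith

lemma cubeFreeEnergy_le_log_hardCoreZ (hlam : 0 ≤ lam) (m : ℕ) (Λ : Finset (Fin d → ℤ)) :
    (cubeFreeEnergy d lam (m + 2) - Real.log (1 + lam) * (1 - ((m : ℝ) / (m + 2)) ^ d)) * Λ.card +
      -cubeFreeEnergy d lam (m + 2) * (collar (latticeGraph d) (d * (m + 2)) Λ).card ≤
        Real.log (hardCoreZ (latticeGraph d) lam Λ) := by
  have hm : 0 < m + 2 := by omega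
  obtain ⟨K, hsub, hcollar⟩ := exists_biUnion_latticeCube_subset hm Λ
  set U := K.biUnion fun k => latticeCube ((m + 2) • k) (m + 2)
  have hcard : (U.card : ℝ) = K.card * ((m : ℝ) + 2) ^ d := by
    exact_mod_cast card_biUnion_latticeCube_nsmul hm K
  have hcube (k : Fin d → ℤ) :=
    cubeFreeEnergy_sub_mul_le_log_hardCoreZ_latticeCube hlam m ((m + 2) • k)
  set f := cubeFreeEnergy d lam (m + 2)
  set γ := Real.log (1 + lam) * (1 - ((m : ℝ) / (m + 2)) ^ d)
  have hf : 0 ≤ f := cubeFreeEnergy_nonneg d hlam _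
  have hγ : 0 ≤ γ := mul_nonneg (Real.log_nonneg (le_add_of_nonneg_right hlam))
    (sub_nonneg.2 (pow_le_one₀ (by positivity)
      (div_le_one_of_le₀ (by linarith) (by positivity))))
  have hUΛ : (U.card : ℝ) ≤ Λ.card := by exact_mod_cast Finset.card_le_card hsub
  have hΛU : (Λ.card : ℝ) - U.card ≤ (collar (latticeGraph d) (d * (m + 2)) Λ).card := by
    rw [← Finset.cast_card_sdiff hsub]
    exact_mod_cast Finset.card_le_card hcollar
  calc (f - γ) * Λ.card + -f * (collar (latticeGraph d) (d * (m + 2)) Λ).card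
      ≤ f * U.card - γ * U.card := by
        linarith [mul_le_mul_of_nonneg_left hΛU hf, mul_le_mul_of_nonneg_left hUΛ hγ]
    _ = ∑ k ∈ K, (f - γ) * ((m : ℝ) + 2) ^ d := by
        rw [hcard, Finset.sum_const, nsmul_eq_mul]
        ring
    _ ≤ _ := Finset.sum_le_sum fun k _ => hcube k
    _ ≤ Real.log (hardCoreZ (latticeGraph d) lam U) :=
        sum_sub_le_log_hardCoreZ_biUnion hlam (pairwise_disjoint_latticeCube_nsmul d hm) K
    _ ≤ Real.log (hardCoreZ (latticeGraph d) lam Λ) :=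
        Real.log_le_log (hardCoreZ_pos _ hlam _) (hardCoreZ_mono hlam hsub)

theorem exists_isFreeEnergy (d : ℕ) (hlam : 0 ≤ lam) : ∃ p : ℝ, IsFreeEnergy d lam p := by
  set f : ℕ → ℝ := fun m => cubeFreeEnergy d lam (m + 2)
  set γ : ℕ → ℝ := fun m => Real.log (1 + lam) * (1 - ((m : ℝ) / (m + 2)) ^ d)
  have hbdd : BddBelow (Set.range f) :=
    ⟨0, Set.forall_mem_range.2 fun m => cubeFreeEnergy_nonneg d hlam _⟩
  have hγ : Filter.Tendsto γ Filter.atTop (nhds 0) := by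
    simpa using (tendsto_one_sub_div_add_two_pow d).const_mul (Real.log (1 + lam))
  refine ⟨⨅ m, f m, fun Λ hΛ => tendsto_order.2 ⟨fun b hb => ?_, fun b hb => ?_⟩⟩
  · obtain ⟨m, hm⟩ := (hγ.eventually_lt_const (sub_pos.2 hb)).exists
    have hbm : b < f m - γ m := by linarith [ciInf_le hbdd m]
    filter_upwards [(hΛ.tendsto_mul_card_add_mul_card_collar_div (d * (m + 2)) (f m - γ m)
      (-f m)).eventually_const_lt hbm] with n hn
    refine hn.trans_le ?_
    gcongr
    exact cubeFreeEnergy_le_log_hardCoreZ hlam m (Λ n)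
  · obtain ⟨m, hm⟩ := exists_lt_of_ciInf_lt hb
    filter_upwards [(hΛ.tendsto_mul_card_add_mul_card_collar_div (d * (m + 2)) (f m)
      (Real.log (1 + lam))).eventually_lt_const hm] with n hn
    refine lt_of_le_of_lt ?_ hn
    gcongr
    exact log_hardCoreZ_le_cubeFreeEnergy hlam (Nat.succ_pos (m + 1)) (Λ n)

end FreeEnergy

section Bounds

variable {d n : ℕ} {lam p x : ℝ}

lemma negLog_of_pos (hx : 0 < x) : negLog x = ((-Real.log x : ℝ) : EReal) := by
  rw [negLog, ENNReal.log_ofReal_of_pos hx, EReal.coe_neg]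

lemma negLog_of_nonpos (hx : x ≤ 0) : negLog x = ⊤ := by
  rw [negLog, ENNReal.log_ofReal, if_pos hx, EReal.neg_bot]

theorem vacancyProb_initialSegment_mem_Icc_cavity
    {e : Finset (Fin d → ℤ) → (Fin d → ℤ) → List (Fin d → ℤ)} (hlam : 0 ≤ lam)
    (he : IsNbrEnum (latticeGraph d) e) {t : ℕ} (htn : t ≤ n) {Λ : Finset (Fin d → ℤ)}
    {v : Fin d → ℤ} (hv : v ∈ Λ \ collar (latticeGraph d) n Λ) :
    vacancyProb (latticeGraph d) lam (initialSegment LexPrec Λ v) v ∈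
      Set.Icc (cavityLower lam e t (halfBall d n) 0) (cavityUpper lam e t (halfBall d n) 0) := by
  obtain ⟨hvΛ, hvc⟩ := Finset.mem_sdiff.1 hv
  rw [← vacancyProb_map _ (latticeShift (-v)), latticeShift_apply, add_neg_cancel]
  refine vacancyProb_mem_Icc_cavity hlam he (zero_mem_halfBall d n) fun u hu => ?_
  have hu' : ∑ j, |u j| ≤ (n : ℤ) := by
    simpa using edist_latticeGraph_le_iff.1 (hu.trans (by exact_mod_cast htn))
  have huΛ : u + v ∈ Λ := mem_of_edist_le_of_notMem_collar hvΛ hvc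
    (edist_latticeGraph_le_iff.2 (by simpa using hu'))
  simp only [halfBall_eq_initialSegment, mem_map_latticeShift, mem_initialSegment,
    mem_latticeBall, sub_neg_eq_add, lexPrec_add_self_iff, add_eq_right, hu', huΛ]

lemma IsFreeEnergy.negLog_le (hp : IsFreeEnergy d lam p) (hlam : 0 ≤ lam) (hx₀ : 0 < x)
    (hx : ∀ Λ, ∀ v ∈ Λ \ collar (latticeGraph d) n Λ,
      vacancyProb (latticeGraph d) lam (initialSegment LexPrec Λ v) v ≤ x) :
    negLog x ≤ (p : EReal) := by
  have hcube := isExhaustion_latticeCube d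
  rw [negLog_of_pos hx₀, EReal.coe_le_coe_iff]
  refine le_of_tendsto_of_tendsto'
    (hcube.tendsto_mul_card_add_mul_card_collar_div n (-Real.log x) (Real.log x))
    (hp _ hcube) fun m => ?_
  gcongr
  exact le_log_hardCoreZ_of_vacancyProb_le hlam (collar_subset n _) (hx _)

lemma IsFreeEnergy.le_negLog (hp : IsFreeEnergy d lam p) (hlam : 0 ≤ lam)
    (hx : ∀ Λ, ∀ v ∈ Λ \ collar (latticeGraph d) n Λ,
      x ≤ vacancyProb (latticeGraph d) lam (initialSegment LexPrec Λ v) v) :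
    (p : EReal) ≤ negLog x := by
  rcases le_or_gt x 0 with hx₀ | hx₀
  · exact negLog_of_nonpos hx₀ ▸ le_top
  have hcube := isExhaustion_latticeCube d
  rw [negLog_of_pos hx₀, EReal.coe_le_coe_iff]
  refine le_of_tendsto_of_tendsto' (hp _ hcube)
    (hcube.tendsto_mul_card_add_mul_card_collar_div n (-Real.log x)
      (Real.log (1 + lam) + Real.log x)) fun m => ?_
  gcongr
  exact log_hardCoreZ_le_of_le_vacancyProb hlam (collar_subset n _) hx₀ (hx _)

theorem IsFreeEnergy.mem_Icc_negLog_cavity (hp : IsFreeEnergy d lam p) (hlam : 0 ≤ lam)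
    {e : Finset (Fin d → ℤ) → (Fin d → ℤ) → List (Fin d → ℤ)}
    (he : IsNbrEnum (latticeGraph d) e) {t : ℕ} (htn : t ≤ n) :
    (p : EReal) ∈ Set.Icc (negLog (cavityUpper lam e t (halfBall d n) 0))
      (negLog (cavityLower lam e t (halfBall d n) 0)) := by
  have hbounds (Λ : Finset (Fin d → ℤ)) (v : Fin d → ℤ)
      (hv : v ∈ Λ \ collar (latticeGraph d) n Λ) :=
    vacancyProb_initialSegment_mem_Icc_cavity hlam he htn hv
  have hpos : 0 < cavityUpper lam e t (halfBall d n) 0 :=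
    (vacancyProb_pos (latticeGraph d) hlam (halfBall d n) 0).trans_le
      (vacancyProb_mem_Icc_cavity hlam he (zero_mem_halfBall d n) fun _ _ => Iff.rfl).2
  exact ⟨hp.negLog_le hlam hpos fun Λ v hv => (hbounds Λ v hv).2,
    hp.le_negLog hlam fun Λ v hv => (hbounds Λ v hv).1⟩

end Bounds

theorem corollary3_general (d : ℕ) {lam : ℝ} (hlam : 0 ≤ lam) :
    ∃ p : ℝ, IsFreeEnergy d lam p ∧
      ∀ e : Finset (Fin d → ℤ) → (Fin d → ℤ) → List (Fin d → ℤ),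
        IsNbrEnum (latticeGraph d) e → ∀ t n : ℕ,
          (2 * t ≤ n →
            negLog (latticePhi d lam e n (2 * t)) ≤ (p : EReal) ∧
            (p : EReal) ≤ negLog (latticePsi d lam e n (2 * t))) ∧
          (2 * t + 1 ≤ n →
            negLog (latticePsi d lam e n (2 * t + 1)) ≤ (p : EReal) ∧
            (p : EReal) ≤ negLog (latticePhi d lam e n (2 * t + 1))) := by
  obtain ⟨p, hp⟩ := exists_isFreeEnergy d hlam
  refine ⟨p, hp, fun e he t n => ⟨fun hn => ?_, fun hn => ?_⟩⟩
  · simpa [cavityLower, cavityUpper, latticePhi, latticePsi] using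
      hp.mem_Icc_negLog_cavity hlam he hn
  · simpa [cavityLower, cavityUpper, latticePhi, latticePsi] using
      hp.mem_Icc_negLog_cavity hlam he hn

theorem corollary3 (d : ℕ) (hd : 1 ≤ d) (Δ : ℕ) (hΔ : 3 ≤ Δ) (hdΔ : 2 * d ≤ Δ)
    (lam : ℝ) (hlam_pos : 0 < lam)
    (hlam : lam < ((Δ : ℝ) - 1) ^ (Δ - 1) / ((Δ : ℝ) - 2) ^ Δ) :
    ∃ p : ℝ, IsFreeEnergy d lam p ∧
      ∀ e : Finset (Fin d → ℤ) → (Fin d → ℤ) → List (Fin d → ℤ),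
        IsNbrEnum (latticeGraph d) e → ∀ t n : ℕ,
          (2 * t + 1 ≤ n →
            negLog (latticePhi d lam e n (2 * t)) ≤ (p : EReal) ∧
            (p : EReal) ≤ negLog (latticePsi d lam e n (2 * t))) ∧
          (2 * t + 1 + 1 ≤ n →
            negLog (latticePsi d lam e n (2 * t + 1)) ≤ (p : EReal) ∧
            (p : EReal) ≤ negLog (latticePhi d lam e n (2 * t + 1))) := by
  obtain ⟨p, hp, hbounds⟩ := corollary3_general d hlam_pos.le
  exact ⟨p, hp, fun e he t n =>
    (hbounds e he t n).imp (· ∘ Nat.le_of_succ_le) (· ∘ Nat.le_of_succ_le)⟩
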